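/- Let $E$ and $F$ be real Banach lattices with topological duals $E'$ and $F'$, which are Banach lattices under the dual norm and the order $f\le g \iff f(x)\le g(x)$ for all $x\ge 0$. A sequence $(x_n)$ in a Banach lattice is \emph{disjoint} if $|x_m|\wedge|x_n|=0$ for all $m\neq n$. A continuous linear operator $S:E\to F$ is \emph{almost M-weakly compact} if $f_n(Sx_n)\to 0$ for every weakly convergent sequence $(f_n)$ in $F'$ and every disjoint norm-bounded sequence $(x_n)$ in $E$. A continuous linear operator $R$ from a Banach lattice to a Banach space is \emph{almost Dunford--Pettis} if $\|Ru_n\|\to 0$ for every disjoint weakly null sequence $(u_n)$ in its domain. For either of these properties $\mathcal P$, an operator between Banach lattices is \emph{regularly} $\mathcal P$ if it is a difference of two positive continuous linear operators each of which has the property $\mathcal P$. \textbf{Theorem.} If a continuous linear operator $T:E\to F$ is regularly almost M-weakly compact, then its adjoint $T':F'\to E'$, $T'f=f\circ T$, is regularly almost Dunford--Pettis; that is, $T'=S_1-S_2$ for some positive almost Dunford--Pettis operators $S_1,S_2:F'\to E'$. -/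

import Mathlib

open Filter Topology

namespace BanachLattice

section Dual

/-! ### The topological dual of a Banach lattice as a Banach lattice

The dual is ordered by `f ≤ g ↔ ∀ x ≥ 0, f x ≤ g x`; the lattice operations are given by the
Riesz--Kantorovich formula `f⁺ x = sup {f y | 0 ≤ y ≤ x}` for `x ≥ 0`. -/

variable {E : Type*} [NormedAddCommGroup E] [NormedSpace ℝ E] [Lattice E] [HasSolidNorm E]
  [IsOrderedAddMonoid E]

set_option linter.unusedSectionVars false

/-- The dual order: `f ≤ g` iff `f x ≤ g x` for all `x ≥ 0`. -/
instance dualPartialOrder : PartialOrder (StrongDual ℝ E) where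
  le f g := ∀ x : E, 0 ≤ x → f x ≤ g x
  le_refl f x _ := le_rfl
  le_trans f g h hfg hgh x hx := (hfg x hx).trans (hgh x hx)
  le_antisymm f g hfg hgf := by
    have key : ∀ x : E, 0 ≤ x → f x = g x := fun x hx => le_antisymm (hfg x hx) (hgf x hx)
    ext x
    rw [← posPart_sub_negPart x, map_sub, map_sub, key _ (posPart_nonneg x),
      key _ (negPart_nonneg x)]

theorem dual_le_iff {f g : StrongDual ℝ E} : f ≤ g ↔ ∀ x : E, 0 ≤ x → f x ≤ g x := Iff.rfl

instance dualIsOrderedAddMonoid : IsOrderedAddMonoid (StrongDual ℝ E) where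
  add_le_add_left f g h k x hx := by
    have := h x hx
    simpa using this

instance dualIsOrderedModule : IsOrderedModule ℝ (StrongDual ℝ E) where
  smul_le_smul_of_nonneg_left a ha f g h x hx := by
    simpa using mul_le_mul_of_nonneg_left (h x hx) ha
  smul_le_smul_of_nonneg_right f hf a b h x hx := by
    have : 0 ≤ f x := by simpa using hf x hx
    simpa using mul_le_mul_of_nonneg_right h this

/-- The Riesz--Kantorovich formula `sup {f y | 0 ≤ y ≤ x}`, used for `x ≥ 0`. -/
noncomputable def rkSup (f : StrongDual ℝ E) (x : E) : ℝ := sSup (f '' Set.Icc 0 x)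

theorem rkSup_bddAbove (f : StrongDual ℝ E) (x : E) : BddAbove (f '' Set.Icc 0 x) := by
  refine ⟨‖f‖ * ‖x‖, ?_⟩
  rintro _ ⟨y, ⟨hy0, hyx⟩, rfl⟩
  have h1 : ‖y‖ ≤ ‖x‖ := HasSolidNorm.solid (by
    rwa [abs_of_nonneg hy0, abs_of_nonneg (hy0.trans hyx)])
  exact (le_abs_self _).trans ((f.le_opNorm y).trans
    (mul_le_mul_of_nonneg_left h1 (norm_nonneg f)))

theorem le_rkSup (f : StrongDual ℝ E) {x y : E} (h0 : 0 ≤ y) (h : y ≤ x) : f y ≤ rkSup f x :=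
  le_csSup (rkSup_bddAbove f x) ⟨y, ⟨h0, h⟩, rfl⟩

theorem rkSup_le (f : StrongDual ℝ E) {x : E} (hx : 0 ≤ x) {c : ℝ}
    (h : ∀ y : E, 0 ≤ y → y ≤ x → f y ≤ c) : rkSup f x ≤ c := by
  refine csSup_le ⟨f 0, 0, ⟨le_rfl, hx⟩, rfl⟩ ?_
  rintro _ ⟨y, ⟨h0, h1⟩, rfl⟩
  exact h y h0 h1

theorem rkSup_nonneg (f : StrongDual ℝ E) {x : E} (hx : 0 ≤ x) : 0 ≤ rkSup f x := by
  simpa using le_rkSup f le_rfl hx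

theorem rkSup_le_norm (f : StrongDual ℝ E) {x : E} (hx : 0 ≤ x) : rkSup f x ≤ ‖f‖ * ‖x‖ := by
  refine rkSup_le f hx fun y h0 h1 => ?_
  have : ‖y‖ ≤ ‖x‖ := HasSolidNorm.solid (by rwa [abs_of_nonneg h0, abs_of_nonneg hx])
  exact (le_abs_self _).trans ((f.le_opNorm y).trans
    (mul_le_mul_of_nonneg_left this (norm_nonneg f)))

theorem rkSup_add (f : StrongDual ℝ E) {x y : E} (hx : 0 ≤ x) (hy : 0 ≤ y) :
    rkSup f (x + y) = rkSup f x + rkSup f y := by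
  apply le_antisymm
  · refine rkSup_le f (add_nonneg hx hy) fun z h0 h1 => ?_
    have e : f z = f (z ⊓ x) + f (z - z ⊓ x) := by rw [← map_add]; congr 1; abel
    rw [e]
    refine add_le_add (le_rkSup f (le_inf h0 hx) inf_le_right)
      (le_rkSup f (sub_nonneg.2 inf_le_left) ?_)
    rw [sub_le_iff_le_add, ← sub_le_iff_le_add']
    exact le_inf (sub_le_self z hy) (sub_le_iff_le_add.2 h1)
  · rw [← le_sub_iff_add_le]
    refine rkSup_le f hx fun a ha0 ha1 => ?_
    rw [le_sub_comm]
    refine rkSup_le f hy fun b hb0 hb1 => ?_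
    rw [le_sub_iff_add_le, ← map_add]
    exact le_rkSup f (add_nonneg hb0 ha0) (by rw [add_comm x y]; exact add_le_add hb1 ha1)

/-- The positive part `f⁺` of a continuous functional, `f⁺ x = rkSup f x⁺ - rkSup f x⁻`. -/
noncomputable def dualPos (f : StrongDual ℝ E) : StrongDual ℝ E :=
  AddMonoidHom.toRealLinearMap
    (AddMonoidHom.mk' (fun x : E => rkSup f x⁺ - rkSup f x⁻) (by
      intro x y
      have h : (x + y)⁺ + (x⁻ + y⁻) = (x⁺ + y⁺) + (x + y)⁻ := by
        rw [sub_eq_iff_eq_add.1 (posPart_sub_negPart (x + y)),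
          sub_eq_iff_eq_add.1 (posPart_sub_negPart x), sub_eq_iff_eq_add.1 (posPart_sub_negPart y)]
        abel
      have h3 := congrArg (rkSup f) h
      rw [rkSup_add f (posPart_nonneg _) (add_nonneg (negPart_nonneg _) (negPart_nonneg _)),
        rkSup_add f (negPart_nonneg _) (negPart_nonneg _),
        rkSup_add f (add_nonneg (posPart_nonneg _) (posPart_nonneg _)) (negPart_nonneg _),
        rkSup_add f (posPart_nonneg _) (posPart_nonneg _)] at h3
      linarith))
    (AddMonoidHomClass.continuous_of_bound _ ‖f‖ (by
      intro x
      have hp : ‖x⁺‖ ≤ ‖x‖ := HasSolidNorm.solid (by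
        rw [abs_of_nonneg (posPart_nonneg x)]; exact sup_le (le_abs_self x) (abs_nonneg x))
      have hn : ‖x⁻‖ ≤ ‖x‖ := HasSolidNorm.solid (by
        rw [abs_of_nonneg (negPart_nonneg x)]; exact sup_le (neg_le_abs x) (abs_nonneg x))
      have h1 := rkSup_nonneg f (posPart_nonneg x)
      have h2 := rkSup_nonneg f (negPart_nonneg x)
      have h3 := (rkSup_le_norm f (posPart_nonneg x)).trans
        (mul_le_mul_of_nonneg_left hp (norm_nonneg f))
      have h4 := (rkSup_le_norm f (negPart_nonneg x)).trans
        (mul_le_mul_of_nonneg_left hn (norm_nonneg f))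
      change ‖rkSup f x⁺ - rkSup f x⁻‖ ≤ _
      rw [Real.norm_eq_abs, abs_le]
      constructor <;> linarith))

theorem dualPos_apply (f : StrongDual ℝ E) {x : E} (hx : 0 ≤ x) :
    dualPos f x = sSup (f '' Set.Icc 0 x) := by
  change rkSup f x⁺ - rkSup f x⁻ = rkSup f x
  have h0 : rkSup f 0 = 0 := by simp [rkSup]
  rw [posPart_of_nonneg hx, negPart_of_nonneg hx, h0, sub_zero]

theorem le_dualPos (f : StrongDual ℝ E) : f ≤ dualPos f := fun x hx => by
  rw [dualPos_apply f hx]; exact le_rkSup f hx le_rfl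

theorem dualPos_nonneg (f : StrongDual ℝ E) : 0 ≤ dualPos f := fun x hx => by
  rw [dualPos_apply f hx]; exact rkSup_nonneg f hx

theorem dualPos_le {f g : StrongDual ℝ E} (hf : f ≤ g) (h0 : 0 ≤ g) : dualPos f ≤ g :=
  fun x hx => by
    rw [dualPos_apply f hx]
    refine rkSup_le f hx fun y hy0 hyx => (hf y hy0).trans ?_
    have := h0 (x - y) (sub_nonneg.2 hyx)
    rw [map_sub] at this
    exact sub_nonneg.1 (by simpa using this)

/-- The lattice structure of the dual order: `f ⊔ g = g + (f - g)⁺` and `f ⊓ g = f - (f - g)⁺`. -/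
noncomputable instance dualLattice : Lattice (StrongDual ℝ E) where
  __ := dualPartialOrder
  sup f g := g + dualPos (f - g)
  inf f g := f - dualPos (f - g)
  le_sup_left f g := sub_le_iff_le_add'.1 (le_dualPos (f - g))
  le_sup_right f g := le_add_of_nonneg_right (dualPos_nonneg (f - g))
  sup_le f g h hf hg := by
    rw [← le_sub_iff_add_le']
    exact dualPos_le (sub_le_sub_right hf g) (sub_nonneg.2 hg)
  inf_le_left f g := sub_le_self f (dualPos_nonneg (f - g))
  inf_le_right f g := sub_le_comm.1 (le_dualPos (f - g))
  le_inf f g h hf hg := by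
    rw [le_sub_comm]
    exact dualPos_le (sub_le_sub_left hg g) (sub_nonneg.2 hf)

theorem abs_apply_le (f : StrongDual ℝ E) (x : E) : |f x| ≤ |f| |x| := by
  have hp := posPart_nonneg x
  have hn := negPart_nonneg x
  have h1 := le_abs_self f _ hp
  have h2 := le_abs_self f _ hn
  have h3 := neg_le_abs f _ hp
  have h4 := neg_le_abs f _ hn
  have h5 : f x = f x⁺ - f x⁻ := by rw [← map_sub, posPart_sub_negPart]
  have h6 : |f| |x| = |f| x⁺ + |f| x⁻ := by rw [← map_add, posPart_add_negPart]
  simp only [neg_apply] at h3 h4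
  rw [h5, h6, abs_le]
  constructor <;> linarith

theorem abs_dual_apply_le (g : StrongDual ℝ E) {x : E} (hx : 0 ≤ x) : |g| x ≤ ‖g‖ * ‖x‖ := by
  have e : |g| x = -g x + rkSup (g - -g) x := by
    change (-g + dualPos (g - -g)) x = _
    rw [add_apply, dualPos_apply _ hx, neg_apply]
    rfl
  suffices h : rkSup (g - -g) x ≤ ‖g‖ * ‖x‖ + g x by rw [e]; linarith
  refine rkSup_le _ hx fun y h0 h1 => ?_
  have hyx : ‖y + y - x‖ ≤ ‖x‖ := HasSolidNorm.solid (by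
    rw [abs_of_nonneg hx]
    refine abs_le'.2 ⟨?_, ?_⟩
    · rw [sub_le_iff_le_add]; exact add_le_add h1 h1
    · rw [neg_sub]; exact sub_le_self _ (add_nonneg h0 h0))
  have h2 := (le_abs_self _).trans ((g.le_opNorm (y + y - x)).trans
    (mul_le_mul_of_nonneg_left hyx (norm_nonneg g)))
  simp only [map_sub, map_add] at h2
  simp only [sub_apply, neg_apply]
  linarith

instance dualHasSolidNorm : HasSolidNorm (StrongDual ℝ E) where
  solid f g h := by
    refine f.opNorm_le_bound (norm_nonneg g) fun x => ?_
    calc ‖f x‖ ≤ |f| |x| := abs_apply_le f x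
      _ ≤ |g| |x| := h _ (abs_nonneg x)
      _ ≤ ‖g‖ * ‖|x|‖ := abs_dual_apply_le g (abs_nonneg x)
      _ = ‖g‖ * ‖x‖ := by rw [norm_abs_eq_norm]

end Dual

section Operators

/-- A sequence in a vector lattice is disjoint if its terms are pairwise disjoint,
`|x m| ∧ |x n| = 0` for `m ≠ n`. -/
def IsDisjointSeq {E : Type*} [AddCommGroup E] [Lattice E] (x : ℕ → E) : Prop :=
  ∀ m n, m ≠ n → |x m| ⊓ |x n| = 0

/-- Weak convergence of a sequence in a normed space. -/
def WeaklyConvergesTo {X : Type*} [NormedAddCommGroup X] [NormedSpace ℝ X]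
    (x : ℕ → X) (a : X) : Prop :=
  Tendsto (fun n => toWeakSpace ℝ X (x n)) atTop (𝓝 (toWeakSpace ℝ X a))

/-- Almost M-weakly compact operators: `f n (T (x n)) → 0` for every weakly convergent sequence
`f` in the dual of `Y` and every disjoint bounded sequence `x` in `E`. -/
def IsAlmostMWeaklyCompact {E Y : Type*} [NormedAddCommGroup E] [NormedSpace ℝ E] [Lattice E]
    [NormedAddCommGroup Y] [NormedSpace ℝ Y] (T : E →L[ℝ] Y) : Prop :=
  ∀ (f : ℕ → StrongDual ℝ Y) (x : ℕ → E), (∃ g, WeaklyConvergesTo f g) →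
    IsDisjointSeq x → Bornology.IsBounded (Set.range x) →
    Tendsto (fun n => f n (T (x n))) atTop (𝓝 0)

/-- Almost Dunford--Pettis operators: disjoint weakly null sequences are mapped to norm null
ones. -/
def IsAlmostDunfordPettis {E Y : Type*} [NormedAddCommGroup E] [NormedSpace ℝ E] [Lattice E]
    [NormedAddCommGroup Y] [NormedSpace ℝ Y] (T : E →L[ℝ] Y) : Prop :=
  ∀ x : ℕ → E, IsDisjointSeq x → WeaklyConvergesTo x 0 →
    Tendsto (fun n => ‖T (x n)‖) atTop (𝓝 0)

/-- An operator is positive if it maps the positive cone into the positive cone. -/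
def IsPositiveOperator {E F : Type*} [NormedAddCommGroup E] [NormedSpace ℝ E] [Lattice E]
    [NormedAddCommGroup F] [NormedSpace ℝ F] [Lattice F] (T : E →L[ℝ] F) : Prop :=
  ∀ x : E, 0 ≤ x → 0 ≤ T x

/-- Regularly `P`-operators: differences of two positive operators with property `P`. -/
def IsRegularly {E F : Type*} [NormedAddCommGroup E] [NormedSpace ℝ E] [Lattice E]
    [NormedAddCommGroup F] [NormedSpace ℝ F] [Lattice F] (P : (E →L[ℝ] F) → Prop)
    (T : E →L[ℝ] F) : Prop :=
  ∃ T₁ T₂ : E →L[ℝ] F, P T₁ ∧ IsPositiveOperator T₁ ∧ P T₂ ∧ IsPositiveOperator T₂ ∧ T = T₁ - T₂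

/-- The adjoint `T' : F' → E'`, `T' f = f ∘ T`. -/
noncomputable def adjointOperator {E F : Type*} [NormedAddCommGroup E] [NormedSpace ℝ E]
    [NormedAddCommGroup F] [NormedSpace ℝ F] (T : E →L[ℝ] F) :
    StrongDual ℝ F →L[ℝ] StrongDual ℝ E :=
  ContinuousLinearMap.precomp ℝ T

end Operators

end BanachLattice

namespace BanachLattice

/-! ### Disjointness in vector lattices. -/

section VectorLattice

variable {E : Type*} [AddCommGroup E] [Lattice E] [IsOrderedAddMonoid E]

/-! Since T' = T₁' - T₂', it suffices that the adjoint of a positive almost M-weakly compact S is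
almost Dunford--Pettis. Let f_n be disjoint and weakly null in F'. A Hahn--Banach argument,
`WeaklyConvergesTo.abs_of_isDisjointSeq`, shows that |f_n| is weakly null too. Hence g_n = S'|f_n|
is positive and weak-* null, and it dominates |S' f_n|, so only ‖g_n‖ → 0 is needed.

The hypothesis on S says that g_n tends to zero along disjoint bounded sequences, also after passing
to subsequences. `tendsto_norm_of_disjoint` turns this into norm convergence: positive vectors y_n
in the unit ball that nearly attain ‖g_n‖ are thinned out and made disjoint by
`isDisjointSeq_posPart_sub`, while the loss in g_n(y_n) tends to zero. -/

/-- For disjoint a and b, the sum |a| + |b| equals ||a| - |b||, and the reverse triangle inequality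
for a and -b applies. -/
theorem abs_add_abs_le_of_disjoint {a b : E} (h : |a| ⊓ |b| = 0) : |a| + |b| ≤ |a + b| := by
  have h1 : |a| + |b| = |(|a| - |b|)| := by
    rw [← sup_sub_inf_eq_abs_sub, inf_comm, sup_comm, h, sub_zero, ← inf_add_sup |a| |b|, h,
      zero_add]
  have h2 := abs_abs_sub_abs_le a (-b)
  rwa [abs_neg, sub_neg_eq_add, ← h1] at h2

theorem inf_add_le_of_nonneg {w u v : E} (hw : 0 ≤ w) (hu : 0 ≤ u) (hv : 0 ≤ v) :
    w ⊓ (u + v) ≤ w ⊓ u + w ⊓ v := by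
  rw [← sub_le_iff_le_add']
  refine le_inf ((sub_le_self _ (le_inf hw hu)).trans inf_le_left) ?_
  rw [sub_le_comm]
  exact le_inf ((sub_le_self _ hv).trans inf_le_left) (sub_le_iff_le_add.2 inf_le_right)

theorem inf_abs_sum_eq_zero {ι : Type*} (s : Finset ι) (v : ι → E) {w : E} (hw : 0 ≤ w)
    (h : ∀ i ∈ s, w ⊓ |v i| = 0) : w ⊓ |∑ i ∈ s, v i| = 0 := by
  classical
  induction s using Finset.induction_on with
  | empty => simpa using hw
  | insert i s hi ih =>
    refine le_antisymm ?_ (le_inf hw (abs_nonneg _))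
    rw [Finset.sum_insert hi]
    calc w ⊓ |v i + ∑ j ∈ s, v j| ≤ w ⊓ (|v i| + |∑ j ∈ s, v j|) :=
          inf_le_inf_left _ (abs_add_le _ _)
      _ ≤ w ⊓ |v i| + w ⊓ |∑ j ∈ s, v j| :=
          inf_add_le_of_nonneg hw (abs_nonneg _) (abs_nonneg _)
      _ = 0 := by
          rw [h i (Finset.mem_insert_self _ _),
            ih fun j hj => h j (Finset.mem_insert_of_mem hj), add_zero]

theorem sum_abs_le_abs_sum_of_disjoint {ι : Type*} (s : Finset ι) (v : ι → E)
    (h : ∀ i j, i ≠ j → |v i| ⊓ |v j| = 0) : ∑ i ∈ s, |v i| ≤ |∑ i ∈ s, v i| := by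
  classical
  induction s using Finset.induction_on with
  | empty => simp
  | insert i s hi ih =>
    rw [Finset.sum_insert hi, Finset.sum_insert hi]
    refine (add_le_add_right ih _).trans (abs_add_abs_le_of_disjoint ?_)
    exact inf_abs_sum_eq_zero s v (abs_nonneg _) fun j hj => h i j (by rintro rfl; exact hi hj)

variable [Module ℝ E] [IsOrderedModule ℝ E]

theorem smul_abs_le_abs_smul (a : ℝ) (x : E) : a • |x| ≤ |a • x| := by
  rcases le_or_gt a 0 with ha | ha
  · exact (smul_nonpos_of_nonpos_of_nonneg ha (abs_nonneg x)).trans (abs_nonneg _)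
  · have h : |x| ≤ a⁻¹ • |a • x| := by
      refine abs_le'.2 ⟨?_, ?_⟩
      · simpa [smul_smul, ha.ne'] using
          smul_le_smul_of_nonneg_left (le_abs_self (a • x)) (inv_nonneg.2 ha.le)
      · simpa [smul_smul, ha.ne'] using
          smul_le_smul_of_nonneg_left (neg_le_abs (a • x)) (inv_nonneg.2 ha.le)
    simpa [smul_smul, ha.ne'] using smul_le_smul_of_nonneg_left h ha.le

theorem abs_smul_le_smul_abs {E : Type*} [AddCommGroup E] [Lattice E] [Module ℝ E]
    [IsOrderedModule ℝ E] (a : ℝ) (x : E) : |a • x| ≤ |a| • |x| := by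
  have h : ∀ y : E, a • y ≤ |a| • |y| := fun y => by
    rcases le_total 0 a with ha | ha
    · rw [abs_of_nonneg ha]
      exact smul_le_smul_of_nonneg_left (le_abs_self y) ha
    · rw [abs_of_nonpos ha, ← neg_smul_neg]
      exact smul_le_smul_of_nonneg_left (neg_le_abs y) (neg_nonneg.2 ha)
  refine abs_le'.2 ⟨h x, ?_⟩
  simpa using h (-x)

theorem inf_smul_eq_zero {u w : E} (hu : 0 ≤ u) (hw : 0 ≤ w) (h : w ⊓ u = 0) {c : ℝ}
    (hc : 0 ≤ c) : w ⊓ c • u = 0 := by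
  refine le_antisymm ?_ (le_inf hw (smul_nonneg hc hu))
  have hc1 : 0 < c + 1 := by linarith
  have hci : 0 ≤ (c + 1)⁻¹ := (inv_pos.2 hc1).le
  -- Both 1/(c+1) and c/(c+1) are at most 1; using c + 1 avoids a separate case c = 0.
  have h1 : (c + 1)⁻¹ • (w ⊓ c • u) ≤ w ⊓ u := by
    refine le_inf ?_ ?_
    · calc (c + 1)⁻¹ • (w ⊓ c • u) ≤ (c + 1)⁻¹ • w :=
            smul_le_smul_of_nonneg_left inf_le_left hci
        _ ≤ (1 : ℝ) • w := smul_le_smul_of_nonneg_right (inv_le_one_of_one_le₀ (by linarith)) hw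
        _ = w := one_smul _ _
    · calc (c + 1)⁻¹ • (w ⊓ c • u) ≤ (c + 1)⁻¹ • (c • u) :=
            smul_le_smul_of_nonneg_left inf_le_right hci
        _ = ((c + 1)⁻¹ * c) • u := smul_smul _ _ _
        _ ≤ (1 : ℝ) • u := smul_le_smul_of_nonneg_right
            (by rw [inv_mul_le_iff₀ hc1]; linarith) hu
        _ = u := one_smul _ _
  rw [h] at h1
  simpa [smul_smul, hc1.ne'] using smul_le_smul_of_nonneg_left h1 hc1.le

theorem smul_disjoint_smul {x y : E} (h : |x| ⊓ |y| = 0) (a b : ℝ) : |a • x| ⊓ |b • y| = 0 := by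
  have h1 : |x| ⊓ |b| • |y| = 0 :=
    inf_smul_eq_zero (abs_nonneg _) (abs_nonneg _) h (abs_nonneg b)
  have h2 : |b| • |y| ⊓ |a| • |x| = 0 :=
    inf_smul_eq_zero (abs_nonneg _) (smul_nonneg (abs_nonneg _) (abs_nonneg _))
      (by rwa [inf_comm]) (abs_nonneg a)
  refine le_antisymm ?_ (le_inf (abs_nonneg _) (abs_nonneg _))
  rw [← h2, inf_comm (|b| • |y|)]
  exact inf_le_inf (abs_smul_le_smul_abs a x) (abs_smul_le_smul_abs b y)

/-- A sequence built from `u` that is disjoint and almost as large as `u`. -/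
theorem isDisjointSeq_posPart_sub {u : ℕ → E} (hu : ∀ k, 0 ≤ u k) {y : E}
    (hy : ∀ k, (2⁻¹ : ℝ) ^ k • u k ≤ y) :
    IsDisjointSeq fun k =>
      (u k - (4 : ℝ) ^ k • ∑ i ∈ Finset.range k, u i - (2⁻¹ : ℝ) ^ k • y)⁺ := by
  have y_nonneg : 0 ≤ y := (smul_nonneg (by positivity) (hu 0)).trans (hy 0)
  have key : ∀ j k, j < k →
      (u j - (4 : ℝ) ^ j • ∑ i ∈ Finset.range j, u i - (2⁻¹ : ℝ) ^ j • y)⁺ ⊓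
        (u k - (4 : ℝ) ^ k • ∑ i ∈ Finset.range k, u i - (2⁻¹ : ℝ) ^ k • y)⁺ = 0 := by
    intro j k hjk
    -- The later term lies below a⁺ and the earlier one below a⁻, and these are disjoint.
    set a := u k - (4 : ℝ) ^ k • u j
    have hk : (u k - (4 : ℝ) ^ k • ∑ i ∈ Finset.range k, u i - (2⁻¹ : ℝ) ^ k • y)⁺ ≤ a⁺ := by
      refine posPart_mono ((sub_le_self _ (smul_nonneg (by positivity) y_nonneg)).trans ?_)
      exact sub_le_sub_left (smul_le_smul_of_nonneg_left
        (Finset.single_le_sum (fun i _ => hu i) (Finset.mem_range.2 hjk)) (by positivity)) _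
    have hj : (u j - (4 : ℝ) ^ j • ∑ i ∈ Finset.range j, u i - (2⁻¹ : ℝ) ^ j • y)⁺ ≤ a⁻ := by
      refine sup_le ?_ (negPart_nonneg a)
      -- Subtracting 2⁻ʲy absorbs 4⁻ᵏu_k, because 2⁻ᵏu_k ≤ y and 2⁻ᵏ ≤ 2⁻ʲ.
      have h1 : u j - (4 : ℝ) ^ j • ∑ i ∈ Finset.range j, u i - (2⁻¹ : ℝ) ^ j • y ≤
          (4⁻¹ : ℝ) ^ k • (-a) := by
        have e : (4⁻¹ : ℝ) ^ k • (-a) = u j - (4⁻¹ : ℝ) ^ k • u k := by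
          simp only [a, neg_sub, smul_sub, smul_smul, ← mul_pow]
          norm_num
        rw [e]
        refine sub_le_sub (sub_le_self _ (smul_nonneg (by positivity)
          (Finset.sum_nonneg fun i _ => hu i))) ?_
        calc (4⁻¹ : ℝ) ^ k • u k ≤ ((2⁻¹ : ℝ) ^ j * (2⁻¹ : ℝ) ^ k) • u k := by
              refine smul_le_smul_of_nonneg_right ?_ (hu k)
              rw [show (4⁻¹ : ℝ) = 2⁻¹ * 2⁻¹ by norm_num, mul_pow]
              exact mul_le_mul_of_nonneg_right
                (pow_le_pow_of_le_one (by norm_num) (by norm_num) hjk.le) (by positivity)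
          _ = (2⁻¹ : ℝ) ^ j • (2⁻¹ : ℝ) ^ k • u k := (smul_smul _ _ _).symm
          _ ≤ (2⁻¹ : ℝ) ^ j • y := smul_le_smul_of_nonneg_left (hy k) (by positivity)
      refine h1.trans ?_
      calc (4⁻¹ : ℝ) ^ k • (-a) ≤ (4⁻¹ : ℝ) ^ k • a⁻ :=
            smul_le_smul_of_nonneg_left (neg_le_negPart a) (by positivity)
        _ ≤ (1 : ℝ) • a⁻ := smul_le_smul_of_nonneg_right
            (pow_le_one₀ (by norm_num) (by norm_num)) (negPart_nonneg a)
        _ = a⁻ := one_smul _ _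
    refine le_antisymm ?_ (le_inf (posPart_nonneg _) (posPart_nonneg _))
    refine (inf_le_inf hj hk).trans ?_
    rw [inf_comm, posPart_inf_negPart_eq_zero]
  intro m n hmn
  simp only [abs_of_nonneg (posPart_nonneg _)]
  rcases hmn.lt_or_gt with h | h
  · exact key m n h
  · rw [inf_comm]; exact key n m h

end VectorLattice

/-! ### Weak convergence, Hahn--Banach extension and extraction of subsequences. -/

theorem weaklyConvergesTo_iff {X : Type*} [NormedAddCommGroup X] [NormedSpace ℝ X]
    {x : ℕ → X} {a : X} :
    WeaklyConvergesTo x a ↔ ∀ φ : StrongDual ℝ X, Tendsto (fun n => φ (x n)) atTop (𝓝 (φ a)) := by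
  refine (WeakBilin.tendsto_iff_forall_eval_tendsto _ ?_).trans Iff.rfl
  intro u v huv
  by_contra hne
  obtain ⟨φ, hφ⟩ := SeparatingDual.exists_separating_of_ne (R := ℝ) hne
  exact hφ (LinearMap.congr_fun huv φ)

/-- Hahn--Banach extension of prescribed values along a family. -/
theorem exists_linearMap_apply_eq_of_le_sublinear {ι V : Type*} [AddCommGroup V] [Module ℝ V]
    (x : ι → V) (c : ι → ℝ) (N : V → ℝ) (N_hom : ∀ a : ℝ, 0 < a → ∀ v, N (a • v) = a * N v)
    (N_add : ∀ v w, N (v + w) ≤ N v + N w)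
    (h : ∀ a : ι →₀ ℝ, a.sum (fun i r => r * c i) ≤ N (Finsupp.linearCombination ℝ x a)) :
    ∃ g : V →ₗ[ℝ] ℝ, (∀ i, g (x i) = c i) ∧ ∀ v, g v ≤ N v := by
  have N_zero : N 0 = 0 := by
    have := N_hom 2 two_pos 0
    rw [smul_zero] at this
    linarith
  set L := Finsupp.linearCombination ℝ x
  set C := Finsupp.linearCombination ℝ c
  have hC : ∀ a, C a ≤ N (L a) := h
  -- The prescribed values are consistent: on a linear relation among the x i, domination for both a
  -- and -a forces C a = 0. So C descends to the span of the x i.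
  have hker : LinearMap.ker L ≤ LinearMap.ker C := fun a ha => by
    rw [LinearMap.mem_ker] at ha ⊢
    have h1 := hC a
    have h2 := hC (-a)
    rw [map_neg, map_neg, ha, neg_zero, N_zero] at h2
    rw [ha, N_zero] at h1
    linarith
  set f : LinearMap.range L →ₗ[ℝ] ℝ :=
    (LinearMap.ker L).liftQ C hker ∘ₗ L.quotKerEquivRange.symm.toLinearMap
  have hf : ∀ a (ha : L a ∈ LinearMap.range L), f ⟨L a, ha⟩ = C a := fun a ha => by
    change (LinearMap.ker L).liftQ C hker (L.quotKerEquivRange.symm ⟨L a, ha⟩) = C a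
    rw [LinearMap.quotKerEquivRange_symm_apply_image]
    exact Submodule.liftQ_apply _ _ _
  obtain ⟨g, hg, hgN⟩ := exists_extension_of_le_sublinear ⟨LinearMap.range L, f⟩ N N_hom N_add (by
    rintro ⟨_, a, rfl⟩
    exact (hf a _).trans_le (hC a))
  refine ⟨g, fun i => ?_, hgN⟩
  have hL : L (Finsupp.single i 1) = x i := by simp [L]
  have := hg ⟨L (Finsupp.single i 1), ⟨_, rfl⟩⟩
  rw [← hL, this]
  exact (hf _ _).trans (by simp [C])

/-- Fast extraction: a subsequence along which each term is small on the sum of the chosen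
predecessors. -/
theorem exists_strictMono_apply_sum_le {E : Type*} [NormedAddCommGroup E]
    [NormedSpace ℝ E] {g : ℕ → StrongDual ℝ E}
    (hg : ∀ x, Tendsto (fun n => g n x) atTop (𝓝 0)) (y : ℕ → E) :
    ∃ φ : ℕ → ℕ, StrictMono φ ∧ ∀ k,
      g (φ k) ((4 : ℝ) ^ k • ∑ i ∈ Finset.range k, y (φ i)) ≤ (2⁻¹ : ℝ) ^ k := by
  have h : ∀ (k N : ℕ) (w : E), ∃ n, N < n ∧ g n w ≤ (2⁻¹ : ℝ) ^ k := fun k N w =>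
    ((eventually_gt_atTop N).and ((hg w).eventually_le_const (by positivity))).exists
  choose F hFN hF using h
  -- The state holds the last chosen index and the sum of the chosen vectors. The initial index 0 is
  -- only a lower bound, hence the shift `k + 1` below.
  let st : ℕ → ℕ × E := fun k => Nat.rec (0, 0)
    (fun k s => (F k s.1 ((4 : ℝ) ^ k • s.2), s.2 + y (F k s.1 ((4 : ℝ) ^ k • s.2)))) k
  have hst : ∀ k, (st k).2 = ∑ i ∈ Finset.range k, y (st (i + 1)).1 := fun k => by
    induction k with
    | zero => rfl
    | succ k ih => rw [Finset.sum_range_succ, ← ih]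
  refine ⟨fun k => (st (k + 1)).1, strictMono_nat_of_lt_succ fun k => hFN _ _ _, fun k => ?_⟩
  rw [← hst]
  exact hF _ _ _

theorem IsPositiveOperator.abs_apply_le {E F : Type*} [NormedAddCommGroup E] [NormedSpace ℝ E]
    [Lattice E] [IsOrderedAddMonoid E] [NormedAddCommGroup F] [NormedSpace ℝ F] [Lattice F]
    [IsOrderedAddMonoid F] {S : E →L[ℝ] F} (hS : IsPositiveOperator S) (x : E) : |S x| ≤ S |x| := by
  refine abs_le'.2 ⟨?_, ?_⟩
  · simpa using hS _ (sub_nonneg.2 (le_abs_self x))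
  · have := hS _ (sub_nonneg.2 (neg_le_abs x))
    rwa [map_sub, map_neg, sub_nonneg] at this

/-! ### Positive functionals, norm convergence and adjoints. -/

section BanachLattice

variable {E : Type*} [NormedAddCommGroup E] [NormedSpace ℝ E] [Lattice E]
  [IsOrderedAddMonoid E]

theorem dual_apply_mono {f : StrongDual ℝ E} (hf : 0 ≤ f) {x y : E} (h : x ≤ y) : f x ≤ f y := by
  have := hf (y - x) (sub_nonneg.2 h)
  rw [map_sub] at this
  exact sub_nonneg.1 (by simpa using this)

theorem dual_apply_nonneg {f : StrongDual ℝ E} (hf : 0 ≤ f) {x : E} (h : 0 ≤ x) : 0 ≤ f x := by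
  simpa using dual_apply_mono hf h

theorem apply_abs_smul [IsOrderedModule ℝ E] {φ : StrongDual ℝ E} (hφ : 0 ≤ φ) {a : ℝ} (ha : 0 < a) (v : E) :
    φ |a • v| = a * φ |v| := by
  apply le_antisymm
  · have := dual_apply_mono hφ (abs_smul_le_smul_abs a v)
    rwa [map_smul, smul_eq_mul, abs_of_pos ha] at this
  · have := dual_apply_mono hφ (smul_abs_le_abs_smul a v)
    rwa [map_smul, smul_eq_mul] at this

variable [HasSolidNorm E]

theorem IsPositiveOperator.adjointOperator {F : Type*} [NormedAddCommGroup F] [NormedSpace ℝ F]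
    [Lattice F] [HasSolidNorm F] [IsOrderedAddMonoid F] {S : E →L[ℝ] F}
    (hS : IsPositiveOperator S) : IsPositiveOperator (adjointOperator S) :=
  fun _ hf x hx => dual_apply_nonneg hf (hS x hx)

theorem exists_nonneg_le_apply {g : StrongDual ℝ E} (hg : 0 ≤ g) :
    ∃ y : E, 0 ≤ y ∧ ‖y‖ ≤ 1 ∧ ‖g‖ / 2 ≤ g y := by
  rcases (norm_nonneg g).eq_or_lt with h | h
  · exact ⟨0, le_rfl, by simp, by simp [← h]⟩
  · obtain ⟨x, hx, hgx⟩ := g.exists_lt_apply_of_lt_opNorm (half_lt_self h)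
    refine ⟨|x|, abs_nonneg x, by rw [norm_abs_eq_norm]; exact hx.le, hgx.le.trans ?_⟩
    refine abs_le.2 ⟨?_, dual_apply_mono hg (le_abs_self x)⟩
    have := dual_apply_mono hg (neg_le_abs x)
    rw [map_neg] at this
    linarith

variable [IsOrderedModule ℝ E]

/-- Disjointness gives ∑ aᵢ|xᵢ| ≤ |∑ aᵢxᵢ|, so the assignment xᵢ ↦ φ|xᵢ| is dominated by the
sublinear functional v ↦ φ|v| and extends by Hahn--Banach. The extension is bounded by ‖φ‖. -/
theorem exists_dual_apply_eq_apply_abs {x : ℕ → E} (hx : IsDisjointSeq x) {φ : StrongDual ℝ E}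
    (hφ : 0 ≤ φ) : ∃ ψ : StrongDual ℝ E, ∀ n, ψ (x n) = φ |x n| := by
  obtain ⟨g, hgx, hg⟩ := exists_linearMap_apply_eq_of_le_sublinear x (fun n => φ |x n|)
    (fun v => φ |v|) (fun a ha v => apply_abs_smul hφ ha v)
    (fun v w => (dual_apply_mono hφ (abs_add_le v w)).trans_eq (map_add _ _ _)) (fun a => by
      calc a.sum (fun i r => r * φ |x i|) ≤ ∑ i ∈ a.support, φ |a i • x i| := by
            refine Finset.sum_le_sum fun i _ => ?_
            have := dual_apply_mono hφ (smul_abs_le_abs_smul (a i) (x i))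
            rwa [map_smul, smul_eq_mul] at this
        _ = φ (∑ i ∈ a.support, |a i • x i|) := (map_sum _ _ _).symm
        _ ≤ φ |∑ i ∈ a.support, a i • x i| := dual_apply_mono hφ
            (sum_abs_le_abs_sum_of_disjoint _ _ fun i j hij => smul_disjoint_smul (hx i j hij) _ _))
  refine ⟨g.mkContinuous ‖φ‖ fun v => ?_, hgx⟩
  have hN : ∀ v : E, g v ≤ ‖φ‖ * ‖v‖ := fun v => (hg v).trans <|
    (le_abs_self _).trans ((φ.le_opNorm _).trans_eq (by rw [norm_abs_eq_norm]))
  refine abs_le.2 ⟨?_, hN v⟩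
  have := hN (-v)
  rw [map_neg, norm_neg] at this
  linarith

/-- The moduli of a disjoint weakly null sequence form a weakly null sequence. -/
theorem WeaklyConvergesTo.abs_of_isDisjointSeq {x : ℕ → E} (hx : IsDisjointSeq x)
    (h : WeaklyConvergesTo x 0) : WeaklyConvergesTo (fun n => |x n|) 0 := by
  rw [weaklyConvergesTo_iff] at h ⊢
  intro φ
  obtain ⟨ψ, hψ⟩ := exists_dual_apply_eq_apply_abs hx (abs_nonneg φ)
  have h1 := h ψ
  simp only [hψ, map_zero] at h1
  rw [map_zero]
  refine squeeze_zero_norm (fun n => ?_) h1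
  simpa using abs_apply_le φ |x n|

variable [CompleteSpace E]

/-- A weak-* null sequence of positive functionals is norm null if its subsequences tend to zero
along disjoint bounded sequences. -/
theorem tendsto_norm_of_disjoint {g : ℕ → StrongDual ℝ E} (g_nonneg : ∀ n, 0 ≤ g n)
    (hg : ∀ x, Tendsto (fun n => g n x) atTop (𝓝 0))
    (h : ∀ φ : ℕ → ℕ, Tendsto φ atTop atTop → ∀ x : ℕ → E, IsDisjointSeq x →
      Bornology.IsBounded (Set.range x) → Tendsto (fun n => g (φ n) (x n)) atTop (𝓝 0)) :
    Tendsto (fun n => ‖g n‖) atTop (𝓝 0) := by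
  refine tendsto_of_subseq_tendsto fun ns hns => ?_
  choose y y_nonneg y_norm hy using fun n => exists_nonneg_le_apply (g_nonneg (ns n))
  obtain ⟨φ, hφ, hφg⟩ := exists_strictMono_apply_sum_le
    (g := fun n => g (ns n)) (fun x => (hg x).comp hns) y
  refine ⟨φ, ?_⟩
  have hnsφ : Tendsto (fun k => ns (φ k)) atTop atTop := hns.comp hφ.tendsto_atTop
  have hsum : Summable fun k => (2⁻¹ : ℝ) ^ k • y (φ k) := by
    refine Summable.of_norm_bounded (g := fun k => (2⁻¹ : ℝ) ^ k)
      (summable_geometric_of_lt_one (by norm_num) (by norm_num)) fun k => ?_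
    rw [norm_smul, Real.norm_of_nonneg (by positivity)]
    exact mul_le_of_le_one_right (by positivity) (y_norm _)
  -- Completeness supplies the common upper bound required for making the sequence disjoint.
  set z := ∑' k, (2⁻¹ : ℝ) ^ k • y (φ k)
  have hz : ∀ k, (2⁻¹ : ℝ) ^ k • y (φ k) ≤ z := fun k =>
    hsum.le_tsum k fun j _ => smul_nonneg (by positivity) (y_nonneg _)
  have z_nonneg : 0 ≤ z := (smul_nonneg (by positivity) (y_nonneg _)).trans (hz 0)
  set x : ℕ → E := fun k =>
    (y (φ k) - (4 : ℝ) ^ k • ∑ i ∈ Finset.range k, y (φ i) - (2⁻¹ : ℝ) ^ k • z)⁺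
  have hx : IsDisjointSeq x := isDisjointSeq_posPart_sub (fun k => y_nonneg _) hz
  have x_le : ∀ k, x k ≤ y (φ k) := fun k => by
    refine sup_le ?_ (y_nonneg _)
    exact (sub_le_self _ (smul_nonneg (by positivity) z_nonneg)).trans (sub_le_self _
      (smul_nonneg (by positivity) (Finset.sum_nonneg fun i _ => y_nonneg _)))
  have x_bdd : Bornology.IsBounded (Set.range x) := by
    refine isBounded_iff_forall_norm_le.2 ⟨1, ?_⟩
    rintro _ ⟨k, rfl⟩
    refine (norm_le_norm_of_abs_le_abs ?_).trans (y_norm (φ k))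
    rw [abs_of_nonneg (posPart_nonneg _), abs_of_nonneg (y_nonneg _)]
    exact x_le k
  have h1 := h _ hnsφ x hx x_bdd
  have h2 : Tendsto (fun k : ℕ => (2⁻¹ : ℝ) ^ k) atTop (𝓝 0) :=
    tendsto_pow_atTop_nhds_zero_of_lt_one (by norm_num) (by norm_num)
  have h3 : Tendsto (fun k => g (ns (φ k)) z) atTop (𝓝 0) := (hg z).comp hnsφ
  have h4 := ((h1.add h2).add (h2.mul h3)).const_mul 2
  simp only [add_zero, mul_zero] at h4
  -- Writing g_k for g (ns (φ k)), the bound is ‖g_k‖ ≤ 2 (g_k(x_k) + 2⁻ᵏ + 2⁻ᵏ g_k(z)): near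
  -- attainment costs the factor 2, the predecessors 2⁻ᵏ, and z the last term.
  refine squeeze_zero (fun _ => norm_nonneg _) (fun k => ?_) h4
  have h5 := dual_apply_mono (g_nonneg (ns (φ k))) (le_posPart
    (y (φ k) - (4 : ℝ) ^ k • ∑ i ∈ Finset.range k, y (φ i) - (2⁻¹ : ℝ) ^ k • z))
  rw [map_sub, map_sub, map_smul _ _ z, smul_eq_mul] at h5
  have h6 := hφg k
  have h7 := hy (φ k)
  change _ ≤ g (ns (φ k)) (x k) at h5
  linarith

variable {F : Type*} [NormedAddCommGroup F] [NormedSpace ℝ F] [Lattice F] [HasSolidNorm F]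
  [IsOrderedAddMonoid F]

theorem IsAlmostMWeaklyCompact.adjointOperator {S : E →L[ℝ] F} (hS : IsPositiveOperator S)
    (h : IsAlmostMWeaklyCompact S) : IsAlmostDunfordPettis (adjointOperator S) := by
  intro f hf hf0
  have hw := WeaklyConvergesTo.abs_of_isDisjointSeq hf hf0
  have key : Tendsto (fun n => ‖BanachLattice.adjointOperator S |f n|‖) atTop (𝓝 0) := by
    refine tendsto_norm_of_disjoint (fun n => hS.adjointOperator _ (abs_nonneg _)) (fun x => ?_) ?_
    · have := weaklyConvergesTo_iff.1 hw (ContinuousLinearMap.apply ℝ ℝ (S x))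
      rwa [map_zero] at this
    · intro φ hφ x hx hb
      -- Here S'|f_n| is evaluated at x_n as |f_n|(S x_n), so weak convergence of the moduli is
      -- exactly what the hypothesis on S needs.
      exact h (fun n => |f (φ n)|) x ⟨0, hw.comp hφ⟩ hx hb
  refine squeeze_zero (fun _ => norm_nonneg _) (fun n => ?_) key
  refine norm_le_norm_of_abs_le_abs ?_
  exact (hS.adjointOperator.abs_apply_le (f n)).trans (le_abs_self _)

end BanachLattice

end BanachLattice

theorem mainTheorem9 {E F : Type*}
    [NormedAddCommGroup E] [NormedSpace ℝ E] [CompleteSpace E]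
    [Lattice E] [IsOrderedAddMonoid E] [IsOrderedModule ℝ E] [HasSolidNorm E]
    [NormedAddCommGroup F] [NormedSpace ℝ F] [CompleteSpace F]
    [Lattice F] [IsOrderedAddMonoid F] [IsOrderedModule ℝ F] [HasSolidNorm F]
    (T : E →L[ℝ] F)
    (hT : BanachLattice.IsRegularly BanachLattice.IsAlmostMWeaklyCompact T) :
    BanachLattice.IsRegularly BanachLattice.IsAlmostDunfordPettis
      (BanachLattice.adjointOperator T) := by
  obtain ⟨T₁, T₂, h₁, p₁, h₂, p₂, rfl⟩ := hT
  refine ⟨_, _, h₁.adjointOperator p₁, p₁.adjointOperator, h₂.adjointOperator p₂,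
    p₂.adjointOperator, ?_⟩
  ext f x
  exact map_sub f _ _
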